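/- Let $k$ be an algebraically closed field of characteristic $0$, let $A$ be a finitely generated commutative associative unital $k$-algebra, $X=\operatorname{Spec}A$, and let $\mathfrak g$ be a finite-dimensional reductive Lie algebra over $k$. Let $\Gamma$ be a group of order two acting on $A$ (equivalently, on $X$) and on $\mathfrak g$ by $k$-algebra and $k$-Lie algebra automorphisms, respectively. The actions are arbitrary; in particular either of them may be trivial. Let $\mathfrak M=M(X,\mathfrak g)^\Gamma=(\mathfrak g\otimes_k A)^\Gamma$ be the Lie algebra of $\Gamma$-equivariant regular maps $X\to\mathfrak g$. For a rational point $x$ of $X$ (a $k$-algebra homomorphism $A\to k$) let $\Gamma_x$ be its isotropy group and $\mathfrak g^x=\{u\in\mathfrak g:\gamma\cdot u=u \text{ for all }\gamma\in\Gamma_x\}$; evaluation at $x$ is a Lie algebra homomorphism $\mathfrak M\to\mathfrak g^x$, $\alpha\mapsto\alpha(x)$. An *evaluation representation* of $\mathfrak M$ is a representation isomorphic to one of the form $$\mathfrak M\to\bigoplus_{x\in\mathbf x}\mathfrak g^x\to\operatorname{End}_k\Big(\bigotimes_{x\in\mathbf x}V_x\Big),\qquad \alpha\mapsto\sum_{x\in\mathbf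 x}1\otimes\cdots\otimes\rho_x(\alpha(x))\otimes\cdots\otimes1,$$ where $\mathbf x$ is a finite (possibly empty) set of rational points of $X$ lying in pairwise disjoint $\Gamma$-orbits and, for each $x\in\mathbf x$, $\rho_x:\mathfrak g^x\to\operatorname{End}_k V_x$ is a nonzero finite-dimensional representation. For a Lie algebra homomorphism $\lambda:\mathfrak M\to k$ (that is, a linear form vanishing on $[\mathfrak M,\mathfrak M]$), let $k_\lambda$ be the one-dimensional representation of $\mathfrak M$ on $k$ given by $\alpha\cdot a=\lambda(\alpha)a$. For $\mathfrak M$-modules $V,W$, let $\operatorname{Ext}^1_{\mathfrak M}(V,W)$ be the set of equivalence classes of extensions $0\to W\to U\to V\to0$ of $\mathfrak M$-modules. Then $\mathfrak M$ is extension-local: if $V$ is an irreducible finite-dimensional evaluation representation of $\mathfrak M$ and $k_\lambda$ is a one-dimensional representation of $\mathfrak M$ that is not an evaluation representation, then $\operatorname{Ext}^1_{\mathfrak M}(V,k_\lambda)=0$; that is, every extension of $V$ by $k_\lambda$ splits. -/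

import Mathlib

open scoped TensorProduct

namespace EquivariantMap

universe u v w

section LieAut

/-- The automorphisms of a Lie algebra form a group under composition. -/
instance lieAutGroup {k : Type*} {L : Type*} [CommRing k] [LieRing L] [LieAlgebra k L] :
    Group (L ≃ₗ⁅k⁆ L) where
  mul f g := g.trans f
  one := LieEquiv.refl
  inv f := f.symm
  mul_assoc _ _ _ := rfl
  one_mul _ := rfl
  mul_one _ := rfl
  inv_mul_cancel f := by
    apply DFunLike.ext
    intro x
    exact f.symm_apply_apply x

theorem lieAut_mul_apply {k : Type*} {L : Type*} [CommRing k] [LieRing L] [LieAlgebra k L]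
    (f g : L ≃ₗ⁅k⁆ L) (x : L) : (f * g) x = f (g x) := rfl

theorem lieAut_one_apply {k : Type*} {L : Type*} [CommRing k] [LieRing L] [LieAlgebra k L]
    (x : L) : (1 : L ≃ₗ⁅k⁆ L) x = x := rfl

end LieAut

/-- A (finite-dimensional, characteristic zero) Lie algebra is reductive if its adjoint
representation is completely reducible: every ideal has a complementary ideal. -/
def IsReductive (k : Type*) (g : Type*) [Field k] [LieRing g] [LieAlgebra k g] : Prop :=
  ComplementedLattice (LieIdeal k g)

section Modules

variable (k : Type u) (L : Type*) [Field k] [LieRing L] [LieAlgebra k L]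

/-- The one-dimensional representation `k_χ`: the space `k` with `l • a = χ(l) a`. -/
def OneDim {k : Type u} {L : Type*} [Field k] [LieRing L] [LieAlgebra k L]
    (_χ : LieAlgebra.LieCharacter k L) : Type u := k

instance (χ : LieAlgebra.LieCharacter k L) : AddCommGroup (OneDim χ) :=
  inferInstanceAs (AddCommGroup k)

instance (χ : LieAlgebra.LieCharacter k L) : Module k (OneDim χ) :=
  inferInstanceAs (Module k k)

instance (χ : LieAlgebra.LieCharacter k L) : LieRingModule L (OneDim χ) where
  bracket l a := (χ l • a : OneDim χ)
  add_lie l l' a := by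
    rw [map_add, add_smul]
  lie_add l a b := smul_add (χ l) a b
  leibniz_lie l l' a := by
    change χ l • χ l' • a = χ ⁅l, l'⁆ • a + χ l' • χ l • a
    rw [LieAlgebra.lieCharacter_apply_lie, zero_smul, zero_add, smul_comm]

instance (χ : LieAlgebra.LieCharacter k L) : LieModule k L (OneDim χ) where
  smul_lie t l a := by
    change χ (t • l) • a = t • χ l • a
    rw [map_smul, smul_assoc]
  lie_smul t l a := by
    change χ l • t • a = t • χ l • a
    rw [smul_comm]

variable (V : Type v) (W : Type w)
  [AddCommGroup V] [Module k V] [LieRingModule L V] [LieModule k L V]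
  [AddCommGroup W] [Module k W] [LieRingModule L W] [LieModule k L W]

/-- An extension of the `L`-module `V` by the `L`-module `W`: a short exact sequence
`0 → W → U → V → 0` of `L`-modules. As a vector space `U` is isomorphic to `V × W`, so the
universe of `U` is no restriction up to equivalence. -/
structure ModuleExtension where
  U : Type (max v w)
  [addCommGroup : AddCommGroup U]
  [module : Module k U]
  [lieRingModule : LieRingModule L U]
  [lieModule : LieModule k L U]
  incl : W →ₗ⁅k,L⁆ U
  proj : U →ₗ⁅k,L⁆ V
  incl_injective : Function.Injective incl
  proj_surjective : Function.Surjective proj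
  exact : Function.Exact incl proj

attribute [instance] ModuleExtension.addCommGroup ModuleExtension.module
  ModuleExtension.lieRingModule ModuleExtension.lieModule

/-- Two extensions are equivalent if there is an isomorphism of the middle modules that is
compatible with the maps from `W` and to `V`. -/
def moduleExtensionSetoid : Setoid (ModuleExtension k L V W) where
  r E F := ∃ f : E.U ≃ₗ⁅k,L⁆ F.U,
    (∀ x, f (E.incl x) = F.incl x) ∧ ∀ y, F.proj (f y) = E.proj y
  iseqv :=
    { refl := fun _ => ⟨LieModuleEquiv.refl, fun _ => rfl, fun _ => rfl⟩
      symm := by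
        rintro E F ⟨f, h₁, h₂⟩
        refine ⟨f.symm, fun x => ?_, fun y => ?_⟩
        · rw [← h₁ x]
          exact f.symm_apply_apply _
        · rw [← h₂ (f.symm y)]
          exact congrArg F.proj (f.apply_symm_apply y)
      trans := by
        rintro E F G ⟨f, h₁, h₂⟩ ⟨g, h₃, h₄⟩
        refine ⟨f.trans g, fun x => ?_, fun y => ?_⟩
        · change g (f (E.incl x)) = G.incl x
          rw [h₁, h₃]
        · change G.proj (g (f y)) = E.proj y
          rw [h₄, h₂] }

/-- `Ext¹_L(V, W)`: the set of equivalence classes of extensions of `V` by `W`. It always contains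
the class of `V ⊕ W`, which is its zero element; hence `Ext¹_L(V, W) = 0` means that this set has
at most one element. -/
def Ext1 : Type _ := Quotient (moduleExtensionSetoid k L V W)

end Modules

section TensorRep

attribute [local instance 100] LieRing.ofAssociativeRing

variable {k : Type*} [Field k] {ι : Type*} [Fintype ι] [DecidableEq ι]
  {W : ι → Type*} [∀ i, AddCommGroup (W i)] [∀ i, Module k (W i)]

/-- The operator `1 ⊗ ⋯ ⊗ f ⊗ ⋯ ⊗ 1` on `⨂ W i`, with `f` in position `i`. -/
noncomputable def actAt (i : ι) :
    Module.End k (W i) →ₗ[k] Module.End k (⨂[k] i, W i) :=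
  (PiTensorProduct.mapMultilinear k W W).toLinearMap (fun _ => 1) i

theorem actAt_apply (i : ι) (f : Module.End k (W i)) :
    actAt i f = PiTensorProduct.map (Function.update (fun j => (1 : Module.End k (W j))) i f) :=
  rfl

theorem actAt_mul (i : ι) (f g : Module.End k (W i)) :
    actAt i (f * g) = actAt i f * actAt i g := by
  rw [actAt_apply, actAt_apply, actAt_apply, ← PiTensorProduct.map_mul]
  congr 1
  funext j
  by_cases h : j = i
  · subst h; simp
  · simp [h]

theorem actAt_comm {i j : ι} (h : i ≠ j) (f : Module.End k (W i)) (g : Module.End k (W j)) :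
    actAt i f * actAt j g = actAt j g * actAt i f := by
  rw [actAt_apply, actAt_apply, ← PiTensorProduct.map_mul, ← PiTensorProduct.map_mul]
  congr 1
  funext l
  by_cases h₁ : l = i
  · subst h₁; simp [h]
  · simp [h₁]

/-- The tensor product of representations `ρ i : L → End (W i)` of a Lie algebra `L`: the element
`u` acts on `⨂ W i` by `∑ i, 1 ⊗ ⋯ ⊗ ρ i u ⊗ ⋯ ⊗ 1`. -/
noncomputable def tensorRep {L : Type*} [LieRing L] [LieAlgebra k L]
    (ρ : ∀ i, L →ₗ⁅k⁆ Module.End k (W i)) : L →ₗ⁅k⁆ Module.End k (⨂[k] i, W i) where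
  toFun u := ∑ i, actAt i (ρ i u)
  map_add' u v := by simp [Finset.sum_add_distrib]
  map_smul' c u := by simp [Finset.smul_sum]
  map_lie' {u v} := by
    change ∑ i, actAt i (ρ i ⁅u, v⁆) = ⁅∑ i, actAt i (ρ i u), ∑ i, actAt i (ρ i v)⁆
    rw [LieRing.of_associative_ring_bracket, Finset.sum_mul_sum, Finset.sum_mul_sum,
      Finset.sum_comm (f := fun i j => actAt i (ρ i v) * actAt j (ρ j u)),
      ← Finset.sum_sub_distrib]
    refine Finset.sum_congr rfl fun i _ => ?_
    rw [← Finset.sum_sub_distrib, Finset.sum_eq_single i]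
    · rw [← actAt_mul, ← actAt_mul, ← map_sub]
      congr 1
      exact (ρ i).map_lie u v
    · intro j _ hj
      rw [actAt_comm hj, sub_self]
    · intro h
      exact absurd (Finset.mem_univ i) h

end TensorRep

section MapAlgebra

variable {k : Type u} {A g Γ : Type*} [Field k] [CommRing A] [Algebra k A]
  [LieRing g] [LieAlgebra k g] [Group Γ]
  (τ : Γ →* (A ≃ₐ[k] A)) (θ : Γ →* (g ≃ₗ⁅k⁆ g))

/-- The equivariant map algebra `M(X, g)^Γ`, where `X = Spec A` and the regular maps from `X` to `g`
are identified with `A ⊗ g`: the fixed points of the diagonal action of `Γ`. -/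
noncomputable def mapAlgebra : LieSubalgebra k (A ⊗[k] g) where
  carrier := {α | ∀ γ : Γ, LieAlgebra.ExtendScalars.map
    ((τ γ : A ≃ₐ[k] A) : A →ₐ[k] A) ((θ γ : g ≃ₗ⁅k⁆ g) : g →ₗ⁅k⁆ g) α = α}
  add_mem' {a b} ha hb γ := by rw [map_add, ha γ, hb γ]
  zero_mem' γ := map_zero _
  smul_mem' c a ha γ := by rw [map_smul, ha γ]
  lie_mem' {a b} ha hb γ := by
    have h₁ := ha γ
    have h₂ := hb γ
    rw [LieHom.map_lie, h₁, h₂]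

/-- The action of `Γ` on the rational points of `X = Spec A`. A rational point is given by the
`k`-algebra homomorphism `x : A → k`, `a ↦ a(x)`; its ideal is the kernel. The action on points and
the action on functions are related by `a(γ • x) = (γ⁻¹ • a)(x)`. -/
def actPoint (γ : Γ) (x : A →ₐ[k] k) : A →ₐ[k] k :=
  x.comp ((τ γ⁻¹ : A ≃ₐ[k] A) : A →ₐ[k] A)

theorem actPoint_apply (γ : Γ) (x : A →ₐ[k] k) (a : A) : actPoint τ γ x a = x (τ γ⁻¹ a) := rfl

theorem actPoint_one (x : A →ₐ[k] k) : actPoint τ 1 x = x := by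
  ext a
  simp [actPoint_apply]

theorem actPoint_mul (γ δ : Γ) (x : A →ₐ[k] k) :
    actPoint τ (γ * δ) x = actPoint τ γ (actPoint τ δ x) := by
  ext a
  simp [actPoint_apply]

/-- The orbit `Γ • x`. -/
def pointOrbit (x : A →ₐ[k] k) : Set (A →ₐ[k] k) := Set.range fun γ : Γ => actPoint τ γ x

/-- The isotropy group `Γ_x`. -/
def isotropyGroup (x : A →ₐ[k] k) : Subgroup Γ where
  carrier := {γ | actPoint τ γ x = x}
  mul_mem' {a b} ha hb := by
    have ha' : actPoint τ a x = x := ha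
    have hb' : actPoint τ b x = x := hb
    change actPoint τ (a * b) x = x
    rw [actPoint_mul, hb', ha']
  one_mem' := actPoint_one τ x
  inv_mem' {a} ha := by
    have ha' : actPoint τ a x = x := ha
    change actPoint τ a⁻¹ x = x
    conv_lhs => rw [← ha']
    rw [← actPoint_mul, inv_mul_cancel, actPoint_one]

/-- The isotropy subalgebra `g^x`, fixed by the isotropy group of `x`. -/
def isotropyAlgebra (x : A →ₐ[k] k) : LieSubalgebra k g where
  carrier := {u | ∀ γ ∈ isotropyGroup τ x, θ γ u = u}
  add_mem' {a b} ha hb γ hγ := by rw [map_add, ha γ hγ, hb γ hγ]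
  zero_mem' γ _ := map_zero _
  smul_mem' c a ha γ hγ := by rw [map_smul, ha γ hγ]
  lie_mem' {a b} ha hb γ hγ := by
    have h₁ := ha γ hγ
    have h₂ := hb γ hγ
    rw [LieEquiv.map_lie, h₁, h₂]

/-- Evaluation of regular maps at the rational point `x`: `a ⊗ u ↦ a(x) u`. -/
noncomputable def evalMap (x : A →ₐ[k] k) : A ⊗[k] g →ₗ⁅k⁆ g where
  toLinearMap := (TensorProduct.lid k g).toLinearMap ∘ₗ
    TensorProduct.map x.toLinearMap LinearMap.id
  map_lie' {α β} := by
    change (TensorProduct.lid k g) (TensorProduct.map x.toLinearMap LinearMap.id ⁅α, β⁆) =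
      ⁅(TensorProduct.lid k g) (TensorProduct.map x.toLinearMap LinearMap.id α),
        (TensorProduct.lid k g) (TensorProduct.map x.toLinearMap LinearMap.id β)⁆
    induction α using TensorProduct.induction_on with
    | zero => simp
    | add α α' h h' => simp only [add_lie, map_add, h, h']
    | tmul a s =>
      induction β using TensorProduct.induction_on with
      | zero => simp
      | add β β' h h' => simp only [lie_add, map_add, h, h']
      | tmul b t => simp [mul_smul, smul_comm (x a) (x b)]

theorem evalMap_tmul (x : A →ₐ[k] k) (a : A) (s : g) :
    evalMap x (a ⊗ₜ[k] s) = x a • s := by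
  change (TensorProduct.lid k g) (TensorProduct.map x.toLinearMap LinearMap.id (a ⊗ₜ[k] s)) = _
  simp

theorem evalMap_map (x : A →ₐ[k] k) (γ : Γ) (α : A ⊗[k] g) :
    evalMap x (LieAlgebra.ExtendScalars.map ((τ γ : A ≃ₐ[k] A) : A →ₐ[k] A)
      ((θ γ : g ≃ₗ⁅k⁆ g) : g →ₗ⁅k⁆ g) α) = θ γ (evalMap (actPoint τ γ⁻¹ x) α) := by
  induction α using TensorProduct.induction_on with
  | zero => simp
  | add α α' h h' => simp only [map_add, h, h']
  | tmul a s => simp [evalMap_tmul, actPoint_apply]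

/-- Evaluation at `x`, as a homomorphism `M(X, g)^Γ → g^x`. -/
noncomputable def evalAt (x : A →ₐ[k] k) : mapAlgebra τ θ →ₗ⁅k⁆ isotropyAlgebra τ θ x where
  toFun α := ⟨evalMap x α, fun γ hγ => by
    have h := evalMap_map τ θ x γ α
    rw [α.2 γ] at h
    have hx : actPoint τ γ⁻¹ x = x := inv_mem hγ
    rw [hx] at h
    exact h.symm⟩
  map_add' α β := Subtype.ext (map_add (evalMap x) (α : A ⊗[k] g) (β : A ⊗[k] g))
  map_smul' c α := Subtype.ext (map_smul (evalMap x) c (α : A ⊗[k] g))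
  map_lie' {α β} := Subtype.ext (LieHom.map_lie (evalMap x) (α : A ⊗[k] g) (β : A ⊗[k] g))

attribute [local instance 100] LieRing.ofAssociativeRing

/-- The data defining an evaluation representation: a finite set of rational points in pairwise
disjoint `Γ`-orbits and, at each of these points `x`, a nonzero finite-dimensional representation
of `g^x`. Every finite-dimensional space is isomorphic to one in the universe of `k`. -/
structure EvalData where
  points : Finset (A →ₐ[k] k)
  disjoint_orbits : (points : Set (A →ₐ[k] k)).PairwiseDisjoint (pointOrbit τ)
  space : points → Type u
  [addCommGroup : ∀ x, AddCommGroup (space x)]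
  [module : ∀ x, Module k (space x)]
  [finite : ∀ x, FiniteDimensional k (space x)]
  [nontrivial : ∀ x, Nontrivial (space x)]
  rep : ∀ x : points, isotropyAlgebra τ θ (x : A →ₐ[k] k) →ₗ⁅k⁆ Module.End k (space x)

attribute [instance] EvalData.addCommGroup EvalData.module EvalData.finite EvalData.nontrivial

open Classical in
/-- The evaluation representation of `M(X, g)^Γ` on `⨂_{x ∈ 𝐱} V_x`: the composition of evaluation
`α ↦ (α(x))_x` with `⨂ ρ_x`, so that `α` acts by `∑ x, 1 ⊗ ⋯ ⊗ ρ_x (α(x)) ⊗ ⋯ ⊗ 1`. -/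
noncomputable def EvalData.evalRep {τ : Γ →* (A ≃ₐ[k] A)} {θ : Γ →* (g ≃ₗ⁅k⁆ g)}
    (D : EvalData τ θ) : mapAlgebra τ θ →ₗ⁅k⁆ Module.End k (⨂[k] x, D.space x) :=
  tensorRep fun x => (D.rep x).comp (evalAt τ θ (x : A →ₐ[k] k))

/-- A module over `M(X, g)^Γ` is an evaluation representation if it is isomorphic to some
`ev_𝐱 (ρ_x)_{x ∈ 𝐱}`. -/
def IsEvaluation (V : Type v) [AddCommGroup V] [Module k V] [LieRingModule (mapAlgebra τ θ) V] :
    Prop :=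
  ∃ (D : EvalData τ θ) (e : V ≃ₗ[k] ⨂[k] x, D.space x),
    ∀ (α : mapAlgebra τ θ) (y : V), e ⁅α, y⁆ = D.evalRep α (e y)

/-- `M(X, g)^Γ` is extension-local: `Ext¹(V, k_χ) = 0` for every irreducible finite-dimensional
evaluation representation `V` and every one-dimensional representation `k_χ` that is not an
evaluation representation. -/
def IsExtensionLocal : Prop :=
  ∀ (V : Type v) [AddCommGroup V] [Module k V] [LieRingModule (mapAlgebra τ θ) V]
    [LieModule k (mapAlgebra τ θ) V] [FiniteDimensional k V]
    [LieModule.IsIrreducible k (mapAlgebra τ θ) V] (χ : LieAlgebra.LieCharacter k (mapAlgebra τ θ)),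
    IsEvaluation τ θ V → ¬ IsEvaluation τ θ (OneDim χ) →
      Subsingleton (Ext1 k (mapAlgebra τ θ) V (OneDim χ))

end MapAlgebra

end EquivariantMap

/-! Suppose `V` is killed by the ideal `N` of the maps vanishing on a finite set `S` of points. If
`χ` vanished on `N`, it would factor through evaluation at `S` and be an evaluation representation
(`isEvaluation_oneDim`); so `χ` is nonzero on `N`. In an extension `U` of `V` by `k_χ`, `N` maps `U`
into `k_χ`, so each `y ∈ U` gives a 1-cocycle `α ↦ α y` on `N` with values in `k_χ`. If all these
cocycles are multiples of `χ`, then for `α ∈ N` with `χ(α) ≠ 0` the map `y ↦ χ(α)⁻¹ α y` is an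
equivariant retraction onto `k_χ`, and the extension splits.

The core is `coboundary_or_evaluation`: a cocycle that is not a multiple of `χ` forces `χ` on `N` to
be evaluation at a `Γ`-fixed point `p` followed by a linear form on `g`; then `χ` factors through
evaluation at `S ∪ {p}`, a contradiction. If `χ` is nonzero on a tensor with central second factor,
the cocycle identity gives proportionality at once. Otherwise reductivity confines `χ` to even
functions tensored with fixed vectors. After subtraction of a coboundary, a nonzero cocycle is a
common eigenvector for multiplication by the even functions vanishing on the orbits of `S`; its
eigenvalues make `χ` multiplicative up to a scalar, and this produces `p`. Order two enters through
the signs: `N` is spanned by tensors `a ⊗ u` with both factors even or both odd. -/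

namespace EquivariantMap

/-! ### Even and odd tensors, and cocycles with values in a character. -/

section Homogeneous

variable {k A g : Type*} [Field k] [CommRing A] [Algebra k A] [LieRing g] [LieAlgebra k g]

/-- `a` and `u` are eigenvectors of `s` and `t` for the same eigenvalue `±1`, so that `a ⊗ u` is
fixed by `s ⊗ t`. -/
def Homog (s : A →ₐ[k] A) (t : g →ₗ⁅k⁆ g) (a : A) (u : g) : Prop :=
  ∃ ε : k, ε * ε = 1 ∧ s a = ε • a ∧ t u = ε • u

variable {s : A →ₐ[k] A} {t : g →ₗ⁅k⁆ g}

theorem Homog.of_fixed {a : A} {u : g} (ha : s a = a) (hu : t u = u) : Homog s t a u :=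
  ⟨1, by simp [ha, hu]⟩

theorem Homog.of_anti {a : A} {u : g} (ha : s a = -a) (hu : t u = -u) : Homog s t a u :=
  ⟨-1, by simp [ha, hu]⟩

theorem Homog.mul_lie {a b : A} {u v : g} (h : Homog s t a u) (h' : Homog s t b v) :
    Homog s t (a * b) ⁅u, v⁆ := by
  obtain ⟨ε, hε, ha, hu⟩ := h
  obtain ⟨δ, hδ, hb, hv⟩ := h'
  refine ⟨ε * δ, ?_, ?_, ?_⟩
  · linear_combination δ * δ * hε + hδ
  · rw [map_mul, ha, hb, smul_mul_smul_comm]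
  · rw [LieHom.map_lie, hu, hv, smul_lie, lie_smul, mul_smul]

theorem Homog.mul_fixed {a b : A} {u : g} (h : Homog s t b u) (ha : s a = a) :
    Homog s t (a * b) u := by
  obtain ⟨ε, hε, hb, hu⟩ := h
  exact ⟨ε, hε, by rw [map_mul, ha, hb, mul_smul_comm], hu⟩

theorem Homog.fixed_lie {b : A} {w u : g} (h : Homog s t b u) (hw : t w = w) :
    Homog s t b ⁅w, u⁆ := by
  obtain ⟨ε, hε, hb, hu⟩ := h
  exact ⟨ε, hε, hb, by rw [LieHom.map_lie, hw, hu, lie_smul]⟩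

theorem Homog.cases {a : A} {u : g} (h : Homog s t a u) :
    (s a = a ∧ t u = u) ∨ (s a = -a ∧ t u = -u) := by
  obtain ⟨ε, hε, ha, hu⟩ := h
  rcases mul_self_eq_one_iff.1 hε with rfl | rfl
  · exact .inl ⟨by rw [ha, one_smul], by rw [hu, one_smul]⟩
  · exact .inr ⟨by rw [ha, neg_smul, one_smul], by rw [hu, neg_smul, one_smul]⟩

theorem exists_even_odd {M : Type*} [AddCommGroup M] [Module k M] [CharZero k]
    (f : M →ₗ[k] M) (hf : ∀ x, f (f x) = x) (x : M) :
    ∃ y z, x = y + z ∧ f y = y ∧ f z = -z := by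
  refine ⟨(2⁻¹ : k) • (x + f x), (2⁻¹ : k) • (x - f x), ?_, ?_, ?_⟩
  · rw [← smul_add, add_add_sub_cancel, ← two_smul k x, smul_smul, inv_mul_cancel₀ two_ne_zero,
      one_smul]
  · rw [map_smul, map_add, hf, add_comm]
  · rw [map_smul, map_sub, hf, ← smul_neg, neg_sub]

/-- A form on `A ⊗ g` that vanishes on brackets of homogeneous tensors, and on homogeneous tensors
with central second factor in `J`, vanishes on the odd tensors of `J` and on the even tensors with
first factor in `J A₁ A₁`. -/
theorem vanishing_of_center [CharZero k] (ht : ∀ u, t (t u) = u)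
    (hg : ∀ F : g →ₗ[k] k, (∀ z, (∀ u : g, ⁅z, u⁆ = 0) → F z = 0) → (∀ p q : g, F ⁅p, q⁆ = 0) → F = 0)
    (J : Ideal A) (lam : A ⊗[k] g →ₗ[k] k)
    (hlam : ∀ a b u v, Homog s t a u → Homog s t b v → lam ((a * b) ⊗ₜ ⁅u, v⁆) = 0)
    (hc : ∀ a ∈ J, ∀ z, (∀ u : g, ⁅z, u⁆ = 0) → Homog s t a z → lam (a ⊗ₜ z) = 0) :
    (∀ a ∈ J, s a = -a → ∀ u, t u = -u → lam (a ⊗ₜ u) = 0) ∧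
    (∀ a ∈ J, s a = a → ∀ f f', s f = -f → s f' = -f' → ∀ u, t u = u →
      lam ((a * f * f') ⊗ₜ u) = 0) := by
  have hcent : ∀ z : g, (∀ u : g, ⁅z, u⁆ = 0) → ∀ u : g, ⁅t z, u⁆ = 0 := fun z hz u => by
    rw [← ht u, ← LieHom.map_lie, hz, map_zero]
  have hdec := exists_even_odd (k := k) (t : g →ₗ[k] g) ht
  simp only [LieHom.coe_toLinearMap] at hdec
  constructor
  · intro a ha hsa u hu
    -- `v - t v` is twice the odd part of `v`; composing with it gives a form on all of `g`, where
    -- reductivity can be applied.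
    let F : g →ₗ[k] k := (lam ∘ₗ TensorProduct.mk k A g a) ∘ₗ (LinearMap.id - (t : g →ₗ[k] g))
    have hF : ∀ v, F v = lam (a ⊗ₜ (v - t v)) := fun v => rfl
    have h0 : F = 0 := by
      refine hg F (fun z hz => ?_) fun p q => ?_
      · rw [hF]
        refine hc a ha _ (fun v => ?_) (.of_anti hsa ?_)
        · rw [sub_lie, hz, hcent z hz, sub_zero]
        · rw [map_sub, ht, neg_sub]
      · obtain ⟨p₀, p₁, rfl, hp₀, hp₁⟩ := hdec p
        obtain ⟨q₀, q₁, rfl, hq₀, hq₁⟩ := hdec q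
        have e : ⁅p₀ + p₁, q₀ + q₁⁆ - t ⁅p₀ + p₁, q₀ + q₁⁆ =
            (2 : k) • ⁅p₀, q₁⁆ + (2 : k) • ⁅p₁, q₀⁆ := by
          simp only [LieHom.map_lie, map_add, hp₀, hp₁, hq₀, hq₁, two_smul, add_lie, lie_add,
            neg_lie, lie_neg]
          abel
        -- The odd part of a bracket pairs an even with an odd vector, so the factorization of `a`
        -- as `1 * a`, with `1` even, suffices.
        have h₁ := hlam 1 a p₀ q₁ (.of_fixed (map_one s) hp₀) (.of_anti hsa hq₁)
        have h₂ := hlam a 1 p₁ q₀ (.of_anti hsa hp₁) (.of_fixed (map_one s) hq₀)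
        rw [one_mul] at h₁
        rw [mul_one] at h₂
        rw [hF, e, TensorProduct.tmul_add, TensorProduct.tmul_smul, TensorProduct.tmul_smul,
          map_add, map_smul, map_smul, h₁, h₂, smul_zero, add_zero]
    have h := LinearMap.congr_fun h0 u
    rw [hF, hu, sub_neg_eq_add, ← two_smul k u, TensorProduct.tmul_smul, map_smul,
      LinearMap.zero_apply, smul_eq_mul] at h
    exact (mul_eq_zero.1 h).resolve_left two_ne_zero
  · intro a ha hsa f f' hf hf' u hu
    have hsf : s (a * f * f') = a * f * f' := by simp [hsa, hf, hf']
    let F : g →ₗ[k] k :=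
      (lam ∘ₗ TensorProduct.mk k A g (a * f * f')) ∘ₗ (LinearMap.id + (t : g →ₗ[k] g))
    have hF : ∀ v, F v = lam ((a * f * f') ⊗ₜ (v + t v)) := fun v => rfl
    have h0 : F = 0 := by
      refine hg F (fun z hz => ?_) fun p q => ?_
      · rw [hF]
        refine hc _ (J.mul_mem_right _ (J.mul_mem_right _ ha)) _ (fun v => ?_) (.of_fixed hsf ?_)
        · rw [add_lie, hz, hcent z hz, zero_add]
        · rw [map_add, ht, add_comm]
      · obtain ⟨p₀, p₁, rfl, hp₀, hp₁⟩ := hdec p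
        obtain ⟨q₀, q₁, rfl, hq₀, hq₁⟩ := hdec q
        have e : ⁅p₀ + p₁, q₀ + q₁⁆ + t ⁅p₀ + p₁, q₀ + q₁⁆ =
            (2 : k) • ⁅p₀, q₀⁆ + (2 : k) • ⁅p₁, q₁⁆ := by
          simp only [LieHom.map_lie, map_add, hp₀, hp₁, hq₀, hq₁, two_smul, add_lie, lie_add,
            neg_lie, lie_neg]
          abel
        have h₁ := hlam (a * f * f') 1 p₀ q₀ (.of_fixed hsf hp₀) (.of_fixed (map_one s) hq₀)
        -- The bracket of two odd vectors needs a product of two odd functions; this is why the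
        -- claim concerns `a * f * f'` and not every even `a`.
        have h₂ := hlam (a * f) f' p₁ q₁ (.of_anti (by simp [hsa, hf]) hp₁) (.of_anti hf' hq₁)
        rw [mul_one] at h₁
        rw [hF, e, TensorProduct.tmul_add, TensorProduct.tmul_smul, TensorProduct.tmul_smul,
          map_add, map_smul, map_smul, h₁, h₂, smul_zero, add_zero]
    have h := LinearMap.congr_fun h0 u
    rw [hF, hu, ← two_smul k u, TensorProduct.tmul_smul, map_smul,
      LinearMap.zero_apply, smul_eq_mul] at h
    exact (mul_eq_zero.1 h).resolve_left two_ne_zero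

/-- A linear form `q` on `A` that is multiplicative up to a scalar on the even part of the ideal `J`
and vanishes on `J A₁ A₁` comes from a rational point fixed by `s`. -/
theorem exists_fixed_point [CharZero k] (hs : ∀ a, s (s a) = a) (J : Ideal A)
    (q : A →ₗ[k] k) (c : k) (hc : c ≠ 0) (a₀ : A) (ha₀ : a₀ ∈ J) (hsa₀ : s a₀ = a₀)
    (hq₀ : q a₀ = 1)
    (hq : ∀ a ∈ J, ∀ b ∈ J, s a = a → s b = b → q (a * b) = c * q a * q b)
    (hodd : ∀ f f', s f = -f → s f' = -f' → q (a₀ * f * f') = 0) :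
    ∃ y : A →ₐ[k] k, (∀ a, y (s a) = y a) ∧ ∀ a ∈ J, s a = a → y a = c * q a := by
  let P : A →ₗ[k] A := (2⁻¹ : k) • (LinearMap.id + s.toLinearMap)
  have hP : ∀ a, P a = (2⁻¹ : k) • (a + s a) := fun a => rfl
  have two : ∀ a : A, (2⁻¹ : k) • (a + a) = a := fun a => by
    rw [← two_smul k a, smul_smul, inv_mul_cancel₀ two_ne_zero, one_smul]
  have hP₀ : ∀ a, s a = a → P a = a := fun a h => by rw [hP, h, two]
  have hP₁ : ∀ a, s a = -a → P a = 0 := fun a h => by rw [hP, h, add_neg_cancel, smul_zero]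
  -- `P` projects onto the even functions, so `Y` is `f ↦ q (f a₀)` there and zero on odd functions.
  -- Multiplicativity on products of two odd functions is exactly `hodd`.
  let Y : A →ₗ[k] k := q ∘ₗ LinearMap.mulRight k a₀ ∘ₗ P
  have hY : ∀ a, Y a = q (P a * a₀) := fun a => rfl
  have hmul₀ : ∀ f f', s f = f → s f' = f' → q (f * f' * a₀) = q (f * a₀) * q (f' * a₀) := by
    intro f f' hf hf'
    have h₁ := hq (f * a₀) (J.mul_mem_left _ ha₀) (f' * a₀) (J.mul_mem_left _ ha₀)
      (by simp [hf, hsa₀]) (by simp [hf', hsa₀])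
    have h₂ := hq (f * f' * a₀) (J.mul_mem_left _ ha₀) a₀ ha₀ (by simp [hf, hf', hsa₀]) hsa₀
    rw [show f * a₀ * (f' * a₀) = f * f' * a₀ * a₀ by ring, h₂, hq₀] at h₁
    apply mul_left_cancel₀ hc
    linear_combination h₁
  have hmul : ∀ f f', Y (f * f') = Y f * Y f' := by
    intro f f'
    obtain ⟨f₀, f₁, rfl, h₀, h₁⟩ := exists_even_odd s.toLinearMap hs f
    obtain ⟨f₀', f₁', rfl, h₀', h₁'⟩ := exists_even_odd s.toLinearMap hs f'
    simp only [AlgHom.toLinearMap_apply] at h₀ h₁ h₀' h₁'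
    have e : (f₀ + f₁) * (f₀' + f₁') = f₀ * f₀' + f₀ * f₁' + f₁ * f₀' + f₁ * f₁' := by ring
    rw [hY, hY, hY, e]
    simp only [map_add]
    rw [hP₀ (f₀ * f₀') (by simp [h₀, h₀']), hP₁ (f₀ * f₁') (by simp [h₀, h₁']),
      hP₁ (f₁ * f₀') (by simp [h₁, h₀']), hP₀ (f₁ * f₁') (by simp [h₁, h₁']), hP₀ _ h₀, hP₀ _ h₀',
      hP₁ _ h₁, hP₁ _ h₁', add_zero, add_zero, add_zero, add_zero, add_mul, map_add,
      hmul₀ _ _ h₀ h₀', show f₁ * f₁' * a₀ = a₀ * f₁ * f₁' by ring, hodd _ _ h₁ h₁', add_zero]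
  have hone : Y 1 = 1 := by rw [hY, hP₀ 1 (map_one s), one_mul, hq₀]
  refine ⟨AlgHom.ofLinearMap Y hone hmul, fun a => ?_, fun a ha hsa => ?_⟩
  · rw [AlgHom.ofLinearMap_apply, AlgHom.ofLinearMap_apply, hY, hY, hP, hP, hs, add_comm]
  · rw [AlgHom.ofLinearMap_apply, hY, hP₀ a hsa, hq a ha a₀ ha₀ hsa hsa₀, hq₀, mul_one]

/-- Let `lam` be a character and `D` a `1`-cocycle with values in `k_lam` on the span of the
homogeneous tensors in `J ⊗ g`. Then `D` is a coboundary, or `lam` is an evaluation at a fixed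
point. -/
theorem coboundary_or_evaluation [CharZero k] (hs : ∀ a, s (s a) = a) (ht : ∀ u, t (t u) = u)
    (hg : ∀ F : g →ₗ[k] k, (∀ z, (∀ u : g, ⁅z, u⁆ = 0) → F z = 0) → (∀ p q : g, F ⁅p, q⁆ = 0) → F = 0)
    (J : Ideal A) (lam D : A ⊗[k] g →ₗ[k] k)
    (hlam : ∀ a b u v, Homog s t a u → Homog s t b v → lam ((a * b) ⊗ₜ ⁅u, v⁆) = 0)
    (hD : ∀ a ∈ J, ∀ b ∈ J, ∀ u v, Homog s t a u → Homog s t b v →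
      D ((a * b) ⊗ₜ ⁅u, v⁆) = lam (a ⊗ₜ u) * D (b ⊗ₜ v) - lam (b ⊗ₜ v) * D (a ⊗ₜ u))
    (hne : ∃ a ∈ J, ∃ u, Homog s t a u ∧ lam (a ⊗ₜ u) ≠ 0) :
    (∃ m : k, ∀ a ∈ J, ∀ u, Homog s t a u → D (a ⊗ₜ u) = m * lam (a ⊗ₜ u)) ∨
    ∃ (y : A →ₐ[k] k) (η : g →ₗ[k] k), (∀ a, y (s a) = y a) ∧ (∃ a ∈ J, y a ≠ 0) ∧
      ∀ a ∈ J, ∀ u, Homog s t a u → lam (a ⊗ₜ u) = y a * η u := by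
  by_cases hc : ∀ a ∈ J, ∀ z, (∀ u : g, ⁅z, u⁆ = 0) → Homog s t a z → lam (a ⊗ₜ z) = 0
  swap
  · push Not at hc
    -- Since `a ⊗ z` commutes with everything, the cocycle identity for it and `b ⊗ v` reads `0 =
    -- lam (a ⊗ z) D (b ⊗ v) - lam (b ⊗ v) D (a ⊗ z)`.
    obtain ⟨a, ha, z, hz, haz, hne⟩ := hc
    refine .inl ⟨D (a ⊗ₜ z) / lam (a ⊗ₜ z), fun b hb v hv => ?_⟩
    have h := hD a ha b hb z v haz hv
    rw [hz, TensorProduct.tmul_zero, map_zero] at h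
    field_simp
    linear_combination -h
  obtain ⟨hodd, heven⟩ := vanishing_of_center ht hg J lam hlam hc
  obtain ⟨a₀, ha₀, w, hw, hsa₀, htw⟩ :
      ∃ a ∈ J, ∃ u, lam (a ⊗ₜ u) = 1 ∧ s a = a ∧ t u = u := by
    obtain ⟨a, ha, u, hau, hne⟩ := hne
    rcases hau.cases with ⟨h₁, h₂⟩ | ⟨h₁, h₂⟩
    · refine ⟨a, ha, (lam (a ⊗ₜ u))⁻¹ • u, ?_, h₁, by rw [map_smul, h₂]⟩
      rw [TensorProduct.tmul_smul, map_smul, smul_eq_mul, inv_mul_cancel₀ hne]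
    · exact absurd (hodd a ha h₁ u h₂) hne
  obtain ⟨m, hm⟩ : ∃ m, m = D (a₀ ⊗ₜ w) := ⟨_, rfl⟩
  -- Subtracting this coboundary normalizes the cocycle to vanish at `a₀ ⊗ w`.
  obtain ⟨E, hE⟩ : ∃ E : A ⊗[k] g →ₗ[k] k, E = D - m • lam := ⟨_, rfl⟩
  have hE' : ∀ x, D x = E x + m * lam x := fun x => by
    rw [hE, LinearMap.sub_apply, LinearMap.smul_apply, smul_eq_mul]; ring
  have hE₀ : E (a₀ ⊗ₜ w) = 0 := by
    have h := hE' (a₀ ⊗ₜ w)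
    rw [hw, ← hm] at h
    linear_combination -h
  have hEc : ∀ a ∈ J, ∀ b ∈ J, ∀ u v, Homog s t a u → Homog s t b v →
      E ((a * b) ⊗ₜ ⁅u, v⁆) = lam (a ⊗ₜ u) * E (b ⊗ₜ v) - lam (b ⊗ₜ v) * E (a ⊗ₜ u) := by
    intro a ha b hb u v hau hbv
    have h := hD a ha b hb u v hau hbv
    rw [hE', hE', hE', hlam a b u v hau hbv] at h
    linear_combination h
  by_cases hEz : ∀ a ∈ J, ∀ u, Homog s t a u → E (a ⊗ₜ u) = 0
  · refine .inl ⟨m, fun a ha u hau => ?_⟩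
    rw [hE', hEz a ha u hau, zero_add]
  push Not at hEz
  obtain ⟨b, hb, u, hbu, hEne⟩ := hEz
  have hHw : ∀ a, s a = a → Homog s t a w := fun a ha => .of_fixed ha htw
  have step₁ : ∀ b ∈ J, ∀ u, Homog s t b u → E ((a₀ * b) ⊗ₜ ⁅w, u⁆) = E (b ⊗ₜ u) := by
    intro b hb u hbu
    rw [hEc a₀ ha₀ b hb w u (hHw a₀ hsa₀) hbu, hw, hE₀]
    ring
  have step₂ : ∀ a ∈ J, s a = a → E (a ⊗ₜ w) = 0 := by
    intro a ha hsa
    rw [← step₁ a ha w (hHw a hsa), lie_self, TensorProduct.tmul_zero, map_zero]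
  -- Bracketing with `a ⊗ w` scales `E` by `lam (a ⊗ w)`, because `E (a ⊗ w) = 0`; by `step₁` the
  -- factor `a₀` can be traded for the bracket with `w`.
  have step₃ : ∀ a ∈ J, s a = a → ∀ b ∈ J, ∀ u, Homog s t b u →
      E ((a * b) ⊗ₜ u) = lam (a ⊗ₜ w) * E ((a₀ * b) ⊗ₜ u) := by
    intro a ha hsa b hb u hbu
    rw [← step₁ (a * b) (J.mul_mem_left _ hb) u (hbu.mul_fixed hsa), mul_left_comm,
      hEc a ha (a₀ * b) (J.mul_mem_left _ hb) w u (hHw a hsa) (hbu.mul_fixed hsa₀),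
      step₂ a ha hsa]
    ring
  have hv : Homog s t b ⁅w, u⁆ := hbu.fixed_lie htw
  set v := ⁅w, u⁆
  have hne₀ : E ((a₀ * b) ⊗ₜ v) ≠ 0 := by rwa [step₁ b hb u hbu]
  set c := lam ((a₀ * a₀) ⊗ₜ w)
  have hsaa : s (a₀ * a₀) = a₀ * a₀ := by rw [map_mul, hsa₀]
  have haab : E ((a₀ * (a₀ * b)) ⊗ₜ v) = c * E ((a₀ * b) ⊗ₜ v) := by
    rw [← mul_assoc]
    exact step₃ _ (J.mul_mem_left _ ha₀) hsaa b hb v hv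
  -- By `step₁` and `step₃`, the nonzero value `E ((a₀ * b) ⊗ v)` is itself a multiple of `c`.
  have hcne : c ≠ 0 := by
    intro h0
    apply hne₀
    have h := step₁ (a₀ * b) (J.mul_mem_left _ hb) v (hv.mul_fixed hsa₀)
    rw [← h, ← mul_assoc, step₃ _ (J.mul_mem_left _ ha₀) hsaa b hb _ (hv.fixed_lie htw)]
    change c * _ = 0
    rw [h0, zero_mul]
  -- Multiply `b` by `a * a'` at once and by the two factors in turn, and compare the eigenvalues.
  have hmul : ∀ a ∈ J, ∀ a' ∈ J, s a = a → s a' = a' →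
      lam ((a * a') ⊗ₜ w) = c * lam (a ⊗ₜ w) * lam (a' ⊗ₜ w) := by
    intro a ha a' ha' hsa hsa'
    apply mul_right_cancel₀ hne₀
    rw [← step₃ (a * a') (J.mul_mem_left _ ha') (by rw [map_mul, hsa, hsa']) b hb v hv, mul_assoc a,
      step₃ a ha hsa (a' * b) (J.mul_mem_left _ hb) v (hv.mul_fixed hsa'), mul_left_comm a₀,
      step₃ a' ha' hsa' (a₀ * b) (J.mul_mem_left _ hb) v (hv.mul_fixed hsa₀), haab]
    ring
  -- Expand `step₃` for `⁅w', v⁆` by the cocycle identity. The terms in `E (a ⊗ w')` and `E (a₀ ⊗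
  -- w')` cancel by `h₄`.
  have hscale : ∀ a ∈ J, s a = a → ∀ w', t w' = w' →
      lam (a ⊗ₜ w') = lam (a ⊗ₜ w) * lam (a₀ ⊗ₜ w') := by
    intro a ha hsa w' hw'
    apply mul_right_cancel₀ hne₀
    have hbJ : a₀ * b ∈ J := J.mul_mem_left _ hb
    have hab := hv.mul_fixed hsa₀
    have h₁ := hEc a ha (a₀ * b) hbJ w' v (.of_fixed hsa hw') hab
    have h₂ := hEc a₀ ha₀ (a₀ * b) hbJ w' v (.of_fixed hsa₀ hw') hab
    have h₃ := step₃ a ha hsa (a₀ * b) hbJ ⁅w', v⁆ (hab.fixed_lie hw')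
    have hww : t ⁅w, w'⁆ = ⁅w, w'⁆ := by rw [LieHom.map_lie, htw, hw']
    have h₄ := step₃ a ha hsa a₀ ha₀ ⁅w, w'⁆ (.of_fixed hsa₀ hww)
    rw [mul_comm a a₀, step₁ a ha w' (.of_fixed hsa hw'),
      step₁ a₀ ha₀ w' (.of_fixed hsa₀ hw')] at h₄
    rw [h₁, h₂] at h₃
    linear_combination h₃ + lam ((a₀ * b) ⊗ₜ v) * h₄
  obtain ⟨y, hy, hyJ⟩ := exists_fixed_point hs J (lam ∘ₗ (TensorProduct.mk k A g).flip w) c hcne a₀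
    ha₀ hsa₀ hw hmul fun f f' hf hf' => heven a₀ ha₀ hsa₀ f f' hf hf' w htw
  simp only [LinearMap.comp_apply, LinearMap.flip_apply, TensorProduct.mk_apply] at hyJ
  refine .inr ⟨y, c⁻¹ • (lam ∘ₗ TensorProduct.mk k A g a₀), hy, ⟨a₀, ha₀, ?_⟩,
    fun a ha u hau => ?_⟩
  · rwa [hyJ a₀ ha₀ hsa₀, hw, mul_one]
  · rcases hau.cases with ⟨h₁, h₂⟩ | ⟨h₁, h₂⟩
    · rw [hscale a ha h₁ u h₂, hyJ a ha h₁]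
      simp only [LinearMap.smul_apply, LinearMap.comp_apply, TensorProduct.mk_apply, smul_eq_mul]
      field_simp
    · have h := hy a
      rw [h₁, map_neg] at h
      rw [hodd a ha h₁ u h₂, self_eq_neg.1 h.symm, zero_mul]

/-- In a reductive Lie algebra a linear form that vanishes on the center and on all brackets is
zero. -/
theorem IsReductive.eq_zero_of_center (hg : IsReductive k g) (F : g →ₗ[k] k)
    (hz : ∀ z, (∀ u : g, ⁅z, u⁆ = 0) → F z = 0) (hb : ∀ p q : g, F ⁅p, q⁆ = 0) : F = 0 := by
  have := hg.exists_isCompl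
  obtain ⟨C, hC⟩ := this ⁅(⊤ : LieIdeal k g), (⊤ : LieIdeal k g)⁆
  have hD : ∀ x ∈ ⁅(⊤ : LieIdeal k g), (⊤ : LieIdeal k g)⁆, F x = 0 := by
    intro x hx
    rw [← LieSubmodule.mem_toSubmodule, LieSubmodule.lieIdeal_oper_eq_linear_span'] at hx
    have : Submodule.span k {m | ∃ x ∈ (⊤ : LieIdeal k g), ∃ n ∈ (⊤ : LieIdeal k g), ⁅x, n⁆ = m} ≤
        LinearMap.ker F := by
      rw [Submodule.span_le]
      rintro _ ⟨p, -, q, -, rfl⟩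
      exact hb p q
    exact this hx
  -- A complement of `[g, g]` is central: its brackets with `g` lie in both ideals.
  have hCz : ∀ z ∈ C, ∀ u : g, ⁅z, u⁆ = 0 := by
    intro z hz u
    have h₁ : ⁅z, u⁆ ∈ C := by
      rw [← lie_skew]
      exact neg_mem (C.lie_mem hz)
    have h₂ : ⁅z, u⁆ ∈ ⁅(⊤ : LieIdeal k g), (⊤ : LieIdeal k g)⁆ :=
      LieSubmodule.lie_mem_lie (LieSubmodule.mem_top _) (LieSubmodule.mem_top _)
    have : ⁅z, u⁆ ∈ ⁅(⊤ : LieIdeal k g), (⊤ : LieIdeal k g)⁆ ⊓ C := ⟨h₂, h₁⟩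
    rwa [hC.inf_eq_bot, LieSubmodule.mem_bot] at this
  ext x
  have hx : x ∈ ⁅(⊤ : LieIdeal k g), (⊤ : LieIdeal k g)⁆ ⊔ C := by
    rw [hC.sup_eq_top]
    exact LieSubmodule.mem_top x
  obtain ⟨p, hp, z, hzC, rfl⟩ := (LieSubmodule.mem_sup _ _ _).1 hx
  rw [map_add, hD p hp, hz z (hCz z hzC), add_zero, LinearMap.zero_apply]

/-- Linear forms on `A ⊗ g` that agree on the homogeneous tensors of `J ⊗ g` agree on all fixed
points of `s ⊗ t` in `J ⊗ g`. -/
theorem eq_of_eq_on_homog [CharZero k] [FiniteDimensional k g] (hs : ∀ a, s (s a) = a)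
    (ht : ∀ u, t (t u) = u) (J : Ideal A) (hJ : ∀ a ∈ J, s a ∈ J) (F G : A ⊗[k] g →ₗ[k] k)
    (hFG : ∀ a ∈ J, ∀ u, Homog s t a u → F (a ⊗ₜ u) = G (a ⊗ₜ u)) (α : A ⊗[k] g)
    (hα : TensorProduct.map s.toLinearMap (t : g →ₗ[k] g) α = α)
    (hαJ : ∀ f : g →ₗ[k] k, TensorProduct.rid k A (f.lTensor A α) ∈ J) : F α = G α := by
  let b := Module.finBasis k g
  have hsum : α = ∑ i, (TensorProduct.rid k A ((b.coord i).lTensor A α)) ⊗ₜ[k] b i := by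
    clear hα hαJ
    induction α using TensorProduct.induction_on with
    | zero => simp
    | add α β h h' =>
      simp only [map_add, TensorProduct.add_tmul, Finset.sum_add_distrib]
      rw [← h, ← h']
    | tmul a u =>
      simp only [LinearMap.lTensor_tmul, TensorProduct.rid_tmul, TensorProduct.smul_tmul]
      rw [← TensorProduct.tmul_sum]
      simp only [Module.Basis.coord_apply]
      rw [b.sum_repr]
  -- In the symmetrization the mixed-parity terms cancel; stability of `J` under `s` keeps the even
  -- and odd parts of `a` in `J`.
  have key : ∀ a ∈ J, ∀ u, F (a ⊗ₜ u + s a ⊗ₜ t u) = G (a ⊗ₜ u + s a ⊗ₜ t u) := by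
    intro a ha u
    obtain ⟨a₀, a₁, e, h₀, h₁⟩ := exists_even_odd s.toLinearMap hs a
    obtain ⟨u₀, u₁, rfl, hu₀, hu₁⟩ := exists_even_odd (t : g →ₗ[k] g) ht u
    simp only [AlgHom.toLinearMap_apply, LieHom.coe_toLinearMap] at h₀ h₁ hu₀ hu₁
    have h2 : ∀ a : A, (2⁻¹ : k) • (a + a) = a := fun a => by
      rw [← two_smul k a, smul_smul, inv_mul_cancel₀ two_ne_zero, one_smul]
    have hJ' : ∀ c : k, ∀ a ∈ J, c • a ∈ J := fun c a ha => by
      rw [Algebra.smul_def]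
      exact J.mul_mem_left _ ha
    have ha₀ : a₀ ∈ J := by
      rw [← h2 a₀, show a₀ + a₀ = a + s a by rw [e, map_add, h₀, h₁]; abel]
      exact hJ' _ _ (J.add_mem ha (hJ a ha))
    have ha₁ : a₁ ∈ J := by
      rw [show a₁ = a - a₀ by rw [e]; abel]
      exact J.sub_mem ha ha₀
    have e' : a ⊗ₜ[k] (u₀ + u₁) + s a ⊗ₜ[k] t (u₀ + u₁) =
        (2 : k) • (a₀ ⊗ₜ[k] u₀) + (2 : k) • (a₁ ⊗ₜ[k] u₁) := by
      rw [e, map_add, map_add, h₀, h₁, hu₀, hu₁]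
      simp only [TensorProduct.tmul_add, TensorProduct.add_tmul, TensorProduct.neg_tmul,
        TensorProduct.tmul_neg, two_smul]
      abel
    rw [e', map_add, map_add, map_smul, map_smul, map_smul, map_smul,
      hFG a₀ ha₀ u₀ (.of_fixed h₀ hu₀), hFG a₁ ha₁ u₁ (.of_anti h₁ hu₁)]
  have h2α : F (α + TensorProduct.map s.toLinearMap (t : g →ₗ[k] g) α) =
      G (α + TensorProduct.map s.toLinearMap (t : g →ₗ[k] g) α) := by
    rw [hsum, map_sum, ← Finset.sum_add_distrib, map_sum, map_sum]
    exact Finset.sum_congr rfl fun i _ => key _ (hαJ (b.coord i)) (b i)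
  rw [hα, map_add, map_add, ← two_mul, ← two_mul] at h2α
  exact mul_left_cancel₀ two_ne_zero h2α

end Homogeneous

/-! ### Surjectivity of evaluation, and characters as evaluation representations. -/

section CharacterEvaluation

variable {k : Type u} {A g Γ : Type*} [Field k] [CommRing A] [Algebra k A]
  [LieRing g] [LieAlgebra k g] [Group Γ]
  (τ : Γ →* (A ≃ₐ[k] A)) (θ : Γ →* (g ≃ₗ⁅k⁆ g))

/-- A rational point is separated from a finite set of other rational points by a function. -/
theorem exists_separating (x : A →ₐ[k] k) (T : Finset (A →ₐ[k] k)) (hx : x ∉ T) :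
    ∃ a, x a = 1 ∧ ∀ y ∈ T, y a = 0 := by
  classical
  induction T using Finset.induction_on with
  | empty => exact ⟨1, map_one x, by simp⟩
  | insert z T _ ih =>
    rw [Finset.mem_insert, not_or] at hx
    obtain ⟨a, ha, haT⟩ := ih hx.2
    obtain ⟨b, hb⟩ : ∃ b, x b ≠ z b := by
      by_contra! h
      exact hx.1 (AlgHom.ext h)
    have hb' : x b - z b ≠ 0 := sub_ne_zero.2 hb
    refine ⟨a * ((x b - z b)⁻¹ • (b - algebraMap k A (z b))), ?_, fun y hy => ?_⟩
    · simp [ha, hb']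
    · rcases Finset.mem_insert.1 hy with rfl | hy
      · simp
      · simp [haT y hy]

/-- The sum over the group, as a map `A ⊗ g → M(X, g)^Γ`. -/
noncomputable def groupSum [Fintype Γ] : A ⊗[k] g →ₗ[k] mapAlgebra τ θ where
  toFun α := ⟨∑ γ : Γ, LieAlgebra.ExtendScalars.map ((τ γ : A ≃ₐ[k] A) : A →ₐ[k] A)
    ((θ γ : g ≃ₗ⁅k⁆ g) : g →ₗ⁅k⁆ g) α, fun δ => by
      rw [map_sum]
      refine Fintype.sum_equiv (Equiv.mulLeft δ) _ _ fun γ => ?_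
      induction α using TensorProduct.induction_on with
      | zero => simp
      | add α β h h' => simp only [map_add, h, h']
      | tmul a u => simp [lieAut_mul_apply]⟩
  map_add' α β := Subtype.ext (by simp [Finset.sum_add_distrib])
  map_smul' c α := Subtype.ext (by simp [Finset.smul_sum])

theorem coe_groupSum [Fintype Γ] (α : A ⊗[k] g) : (groupSum τ θ α : A ⊗[k] g) =
    ∑ γ : Γ, LieAlgebra.ExtendScalars.map ((τ γ : A ≃ₐ[k] A) : A →ₐ[k] A)
      ((θ γ : g ≃ₗ⁅k⁆ g) : g →ₗ⁅k⁆ g) α := rfl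

theorem groupSum_coe [Fintype Γ] (α : mapAlgebra τ θ) :
    groupSum τ θ (α : A ⊗[k] g) = (Fintype.card Γ : k) • α := by
  apply Subtype.ext
  rw [coe_groupSum, Finset.sum_congr rfl fun γ _ => α.2 γ, Finset.sum_const, Finset.card_univ,
    ← Nat.cast_smul_eq_nsmul k]
  rfl

theorem evalMap_groupSum_tmul [Fintype Γ] (x : A →ₐ[k] k) (a : A) (u : g) :
    evalMap x (groupSum τ θ (a ⊗ₜ[k] u) : A ⊗[k] g) =
      ∑ γ : Γ, actPoint τ γ⁻¹ x a • θ γ u := by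
  rw [coe_groupSum, map_sum]
  refine Finset.sum_congr rfl fun γ _ => ?_
  rw [evalMap_map, evalMap_tmul, map_smul]

/-- The evaluation map at finitely many points in disjoint orbits is surjective: there are linear
lifts of each factor. -/
theorem exists_lift [CharZero k] [Finite Γ] (S : Finset (A →ₐ[k] k))
    (hS : (S : Set (A →ₐ[k] k)).PairwiseDisjoint (pointOrbit τ)) (x : A →ₐ[k] k) (hx : x ∈ S) :
    ∃ l : isotropyAlgebra τ θ x →ₗ[k] mapAlgebra τ θ,
      (∀ u, evalMap x (l u : A ⊗[k] g) = u) ∧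
      ∀ y ∈ S, y ≠ x → ∀ u, evalMap y (l u : A ⊗[k] g) = 0 := by
  classical
  have := Fintype.ofFinite Γ
  -- `a` is `1` at `x` and `0` at every other point of the orbits of `S`. In the group sum of `a ⊗
  -- u`, evaluated at `x`, only the isotropy group contributes, each element giving `u`; hence the
  -- division by its order.
  obtain ⟨a, hax, haT⟩ := exists_separating x
    ((Finset.univ ×ˢ S).image (fun p : Γ × (A →ₐ[k] k) => actPoint τ p.1 p.2) |>.erase x)
    (Finset.notMem_erase _ _)
  have ha : ∀ y ∈ S, ∀ γ : Γ, actPoint τ γ y ≠ x → actPoint τ γ y a = 0 := fun y hy γ hne =>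
    haT _ (Finset.mem_erase.2 ⟨hne, Finset.mem_image.2 ⟨(γ, y), by simp [hy], rfl⟩⟩)
  set n := (Finset.univ.filter fun γ : Γ => γ ∈ isotropyGroup τ x).card
  have hn : (n : k) ≠ 0 := by
    rw [Nat.cast_ne_zero, Finset.card_ne_zero]
    exact ⟨1, by simp [one_mem]⟩
  refine ⟨(n : k)⁻¹ • (groupSum τ θ ∘ₗ TensorProduct.mk k A g a ∘ₗ
    (isotropyAlgebra τ θ x).toSubmodule.subtype), fun u => ?_, fun y hy hyx u => ?_⟩
  · change evalMap x ((n : k)⁻¹ • (groupSum τ θ (a ⊗ₜ (u : g)) : A ⊗[k] g)) = u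
    rw [map_smul, evalMap_groupSum_tmul]
    have : ∀ γ : Γ, actPoint τ γ⁻¹ x a • θ γ (u : g) =
        if γ ∈ isotropyGroup τ x then (u : g) else 0 := by
      intro γ
      split_ifs with h
      · rw [u.2 γ h, show actPoint τ γ⁻¹ x = x from inv_mem h, hax, one_smul]
      · rw [ha x hx γ⁻¹ fun e => h (inv_mem_iff.1 e), zero_smul]
    rw [Finset.sum_congr rfl fun γ _ => this γ, ← Finset.sum_filter, Finset.sum_const,
      ← Nat.cast_smul_eq_nsmul k, smul_smul, inv_mul_cancel₀ hn, one_smul]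
  · change evalMap y ((n : k)⁻¹ • (groupSum τ θ (a ⊗ₜ (u : g)) : A ⊗[k] g)) = 0
    rw [map_smul, evalMap_groupSum_tmul, Finset.sum_eq_zero, smul_zero]
    intro γ _
    rw [ha y hy γ⁻¹ fun e => ?_, zero_smul]
    exact Set.disjoint_left.1 (hS hy hx hyx) ⟨γ⁻¹, e⟩ ⟨1, actPoint_one τ x⟩

theorem actAt_one {ι : Type*} [Fintype ι] [DecidableEq ι]
    {W : ι → Type*} [∀ i, AddCommGroup (W i)] [∀ i, Module k (W i)] (i : ι) :
    actAt (k := k) (W := W) i 1 = 1 := by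
  rw [actAt_apply, show (fun j => (1 : Module.End k (W j))) = 1 from rfl,
    ← Pi.one_apply (M := fun j => Module.End k (W j)) i, Function.update_eq_self]
  exact PiTensorProduct.map_one

attribute [local instance 100] LieRing.ofAssociativeRing

/-- The one-dimensional representation of a Lie algebra given by a form vanishing on brackets. -/
noncomputable def scalarRep {L : Type*} [LieRing L] [LieAlgebra k L] (f : L →ₗ[k] k)
    (hf : ∀ u v : L, f ⁅u, v⁆ = 0) : L →ₗ⁅k⁆ Module.End k k where
  toFun u := f u • 1
  map_add' u v := by rw [map_add, add_smul]
  map_smul' c u := by rw [map_smul, smul_assoc, RingHom.id_apply]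
  map_lie' {u v} := by
    change f ⁅u, v⁆ • (1 : Module.End k k) = (f u • 1) * (f v • 1) - (f v • 1) * (f u • 1)
    rw [hf, zero_smul, smul_mul_smul_comm, smul_mul_smul_comm, mul_comm (f u), sub_self]

theorem tensorRep_apply_of_scalar {L : Type*} [LieRing L] [LieAlgebra k L]
    {ι : Type*} [Fintype ι] [DecidableEq ι]
    {W : ι → Type*} [∀ i, AddCommGroup (W i)] [∀ i, Module k (W i)]
    (ρ : ∀ i, L →ₗ⁅k⁆ Module.End k (W i)) (u : L) (c : ι → k) (h : ∀ i, ρ i u = c i • 1) :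
    tensorRep ρ u = (∑ i, c i) • 1 := by
  change ∑ i, actAt i (ρ i u) = _
  rw [Finset.sum_smul]
  refine Finset.sum_congr rfl fun i _ => ?_
  rw [h, map_smul, actAt_one]

/-- A character of `M(X, g)^Γ` that vanishes on all maps vanishing at a given finite set of points
in disjoint orbits is an evaluation representation. -/
theorem isEvaluation_oneDim [CharZero k] [Finite Γ] (S : Finset (A →ₐ[k] k))
    (hS : (S : Set (A →ₐ[k] k)).PairwiseDisjoint (pointOrbit τ))
    (χ : LieAlgebra.LieCharacter k (mapAlgebra τ θ))
    (h : ∀ α : mapAlgebra τ θ, (∀ x ∈ S, evalMap x (α : A ⊗[k] g) = 0) → χ α = 0) :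
    IsEvaluation τ θ (OneDim χ) := by
  classical
  choose l hl hl' using fun x : S => exists_lift τ θ S hS x x.2
  -- The lift `l x` is only linear, but its failure to respect brackets vanishes at every point of
  -- `S` and is therefore invisible to `χ`.
  have hlie : ∀ (x : S) (u v : isotropyAlgebra τ θ (x : A →ₐ[k] k)), χ (l x ⁅u, v⁆) = 0 := by
    intro x u v
    have h₀ := h (l x ⁅u, v⁆ - ⁅l x u, l x v⁆) fun y hy => by
      change evalMap y ((l x ⁅u, v⁆ : A ⊗[k] g) - ⁅(l x u : A ⊗[k] g), (l x v : A ⊗[k] g)⁆) = 0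
      rw [map_sub, LieHom.map_lie]
      by_cases hyx : y = x
      · subst hyx
        rw [hl, hl, hl]
        exact sub_self _
      · rw [hl' x y hy hyx, hl' x y hy hyx, hl' x y hy hyx, zero_lie, sub_zero]
    rwa [map_sub, LieAlgebra.lieCharacter_apply_lie, sub_zero] at h₀
  have hχ : ∀ α, χ α = ∑ x : S, χ (l x (evalAt τ θ (x : A →ₐ[k] k) α)) := by
    intro α
    rw [← map_sum, ← sub_eq_zero, ← map_sub]
    refine h _ fun y hy => ?_
    change evalMap y ((α : A ⊗[k] g) -
      (mapAlgebra τ θ).toSubmodule.subtype (∑ x : S, l x (evalAt τ θ (x : A →ₐ[k] k) α))) = 0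
    rw [map_sub, map_sum, map_sum, Finset.sum_eq_single ⟨y, hy⟩]
    · change evalMap y (α : A ⊗[k] g) -
        evalMap y (l ⟨y, hy⟩ (evalAt τ θ y α) : A ⊗[k] g) = 0
      rw [hl ⟨y, hy⟩]
      exact sub_self _
    · intro x _ hx
      exact hl' x y hy (fun e => hx (Subtype.ext e.symm)) _
    · exact fun hn => absurd (Finset.mem_univ _) hn
  let D : EvalData τ θ :=
    { points := S
      disjoint_orbits := hS
      space := fun _ => k
      rep := fun x => scalarRep ((χ : mapAlgebra τ θ →ₗ[k] k) ∘ₗ l x) (hlie x) }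
  have hD : ∀ α, D.evalRep α = χ α • 1 := by
    intro α
    rw [hχ α]
    exact tensorRep_apply_of_scalar _ α _ fun x => rfl
  let e : k ≃ₗ[k] ⨂[k] _ : S, k := (PiTensorProduct.constantBaseRingEquiv S k).symm.toLinearEquiv
  refine ⟨D, e, fun α y => ?_⟩
  rw [hD]
  exact e.map_smul (χ α) y

/-- An evaluation representation is annihilated by all maps vanishing at a certain finite set of
points in disjoint orbits. -/
theorem IsEvaluation.exists_points {V : Type v} [AddCommGroup V] [Module k V]
    [LieRingModule (mapAlgebra τ θ) V] (hV : IsEvaluation τ θ V) :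
    ∃ S : Finset (A →ₐ[k] k), (S : Set (A →ₐ[k] k)).PairwiseDisjoint (pointOrbit τ) ∧
      ∀ α : mapAlgebra τ θ, (∀ x ∈ S, evalMap x (α : A ⊗[k] g) = 0) → ∀ y : V, ⁅α, y⁆ = 0 := by
  obtain ⟨D, e, he⟩ := hV
  refine ⟨D.points, D.disjoint_orbits, fun α hα y => e.injective ?_⟩
  rw [he, map_zero]
  have : D.evalRep α = 0 := by
    refine Finset.sum_eq_zero fun x _ => ?_
    have : evalAt τ θ (x : A →ₐ[k] k) α = 0 := Subtype.ext (hα x x.2)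
    rw [LieHom.comp_apply, this, map_zero, map_zero]
  rw [this, LinearMap.zero_apply]

end CharacterEvaluation

/-! ### Retractions and the vanishing of `Ext¹`. -/

section Split

variable {k : Type u} {L : Type*} [Field k] [LieRing L] [LieAlgebra k L]
  {V : Type v} {W : Type w}
  [AddCommGroup V] [Module k V] [LieRingModule L V]
  [AddCommGroup W] [Module k W] [LieRingModule L W]

/-- If every extension of `V` by `W` has a retraction, then `Ext¹(V, W) = 0`. -/
theorem subsingleton_ext1
    (h : ∀ E : ModuleExtension k L V W, ∃ r : E.U →ₗ⁅k,L⁆ W, ∀ c, r (E.incl c) = c) :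
    Subsingleton (Ext1 k L V W) := by
  have hbij : ∀ (E : ModuleExtension k L V W) (r : E.U →ₗ⁅k,L⁆ W), (∀ c, r (E.incl c) = c) →
      Function.Bijective ((r : E.U →ₗ[k] W).prod (E.proj : E.U →ₗ[k] V)) := by
    intro E r hr
    constructor
    · rw [← LinearMap.ker_eq_bot, LinearMap.ker_eq_bot']
      intro x hx
      have h₁ : r x = 0 := congrArg Prod.fst hx
      have h₂ : E.proj x = 0 := congrArg Prod.snd hx
      obtain ⟨c, rfl⟩ := (E.exact x).1 h₂
      rw [hr] at h₁
      rw [h₁, map_zero]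
    · rintro ⟨c, v⟩
      obtain ⟨x, rfl⟩ := E.proj_surjective v
      refine ⟨x + E.incl (c - r x), Prod.ext ?_ ?_⟩
      · change r (x + E.incl (c - r x)) = c
        rw [map_add, hr, add_sub_cancel]
      · change E.proj (x + E.incl (c - r x)) = E.proj x
        rw [map_add, (E.exact _).2 ⟨_, rfl⟩, add_zero]
  constructor
  intro a b
  induction a, b using Quotient.inductionOn₂ with
  | _ E F =>
    obtain ⟨r, hr⟩ := h E
    obtain ⟨q, hq⟩ := h F
    let e := LinearEquiv.ofBijective _ (hbij E r hr)
    let f := LinearEquiv.ofBijective _ (hbij F q hq)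
    have hf : ∀ x, q (f.symm (e x)) = r x ∧ F.proj (f.symm (e x)) = E.proj x := fun x =>
      ⟨congrArg Prod.fst (f.apply_symm_apply (e x)), congrArg Prod.snd (f.apply_symm_apply (e x))⟩
    -- The two equivariant maps `q` and `F.proj` jointly separate points, so equivariance of the
    -- comparison map can be tested after applying them.
    have hfinj : ∀ x y : F.U, q x = q y → F.proj x = F.proj y → x = y := fun x y h₁ h₂ =>
      f.injective (Prod.ext h₁ h₂)
    let φ : E.U ≃ₗ⁅k,L⁆ F.U :=
      { e.trans f.symm with
        map_lie' := by
          intro l x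
          change f.symm (e ⁅l, x⁆) = ⁅l, f.symm (e x)⁆
          apply hfinj
          · rw [(hf _).1, LieModuleHom.map_lie, LieModuleHom.map_lie, (hf _).1]
          · rw [(hf _).2, LieModuleHom.map_lie, LieModuleHom.map_lie, (hf _).2] }
    refine Quotient.sound ⟨φ, fun c => hfinj _ _ ?_ ?_, fun x => (hf x).2⟩
    · exact (hf _).1.trans ((hr c).trans (hq c).symm)
    · exact (hf _).2.trans (((E.exact _).2 ⟨c, rfl⟩).trans ((F.exact _).2 ⟨c, rfl⟩).symm)

end Split

/-! ### Splitting of extensions for a group of order two. -/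

section OrderTwo

variable {k : Type u} {A g Γ : Type*} [Field k] [CommRing A] [Algebra k A]
  [LieRing g] [LieAlgebra k g] [Group Γ]
  (τ : Γ →* (A ≃ₐ[k] A)) (θ : Γ →* (g ≃ₗ⁅k⁆ g))

theorem rid_lTensor_evalMap (x : A →ₐ[k] k) (f : g →ₗ[k] k) (α : A ⊗[k] g) :
    x (TensorProduct.rid k A (f.lTensor A α)) = f (evalMap x α) := by
  induction α using TensorProduct.induction_on with
  | zero => simp
  | add α β h h' => simp only [map_add, h, h']
  | tmul a u => simp [evalMap_tmul, mul_comm]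

/-- The ideal of the functions that vanish on the orbits of the points in `S`. -/
noncomputable def orbitIdeal (S : Finset (A →ₐ[k] k)) : Ideal A where
  carrier := {a | ∀ x ∈ S, ∀ γ, actPoint τ γ x a = 0}
  add_mem' ha hb x hx γ := by rw [map_add, ha x hx γ, hb x hx γ, add_zero]
  zero_mem' x _ γ := map_zero _
  smul_mem' c a ha x hx γ := by rw [smul_eq_mul, map_mul, ha x hx γ, mul_zero]

theorem map_mem_orbitIdeal {S : Finset (A →ₐ[k] k)} {a : A} (ha : a ∈ orbitIdeal τ S) (δ : Γ) :
    τ δ a ∈ orbitIdeal τ S := fun x hx γ => by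
  have h := ha x hx (δ⁻¹ * γ)
  rw [actPoint_mul] at h
  simpa [actPoint_apply] using h

/-- By equivariance, vanishing at `x` propagates along the orbit of `x`, so all coordinate functions
of `α` vanish there. -/
theorem rid_lTensor_mem_orbitIdeal {S : Finset (A →ₐ[k] k)} (α : mapAlgebra τ θ)
    (hα : ∀ x ∈ S, evalMap x (α : A ⊗[k] g) = 0) (f : g →ₗ[k] k) :
    TensorProduct.rid k A (f.lTensor A (α : A ⊗[k] g)) ∈ orbitIdeal τ S := fun x hx γ => by
  have h := evalMap_map τ θ x γ⁻¹ (α : A ⊗[k] g)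
  rw [α.2, hα x hx, inv_inv] at h
  rw [rid_lTensor_evalMap, (EmbeddingLike.map_eq_zero_iff (f := θ γ⁻¹)).1 h.symm, map_zero]

/-- For a group of order two, every extension of a module annihilated by the maps vanishing on a
finite set of points by a one-dimensional module that is not an evaluation representation has a
retraction. -/
theorem ModuleExtension.exists_retraction [CharZero k] [FiniteDimensional k g]
    (hg : IsReductive k g) (hΓ : Nat.card Γ = 2)
    {V : Type v} [AddCommGroup V] [Module k V] [LieRingModule (mapAlgebra τ θ) V]
    [LieModule k (mapAlgebra τ θ) V] (χ : LieAlgebra.LieCharacter k (mapAlgebra τ θ))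
    (S : Finset (A →ₐ[k] k)) (hS : (S : Set (A →ₐ[k] k)).PairwiseDisjoint (pointOrbit τ))
    (hSV : ∀ α : mapAlgebra τ θ, (∀ x ∈ S, evalMap x (α : A ⊗[k] g) = 0) → ∀ y : V, ⁅α, y⁆ = 0)
    (hχ : ¬ IsEvaluation τ θ (OneDim χ))
    (E : ModuleExtension k (mapAlgebra τ θ) V (OneDim χ)) :
    ∃ r : E.U →ₗ⁅k,mapAlgebra τ θ⁆ OneDim χ, ∀ c, r (E.incl c) = c := by
  classical
  have : Finite Γ := Nat.finite_of_card_ne_zero (by omega)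
  have := Fintype.ofFinite Γ
  obtain ⟨σ, hσ, hσ'⟩ := (Nat.card_eq_two_iff' (1 : Γ)).1 hΓ
  have hσσ : σ * σ = 1 := by
    rw [← sq, ← hΓ]
    exact pow_card_eq_one'
  have hall : ∀ γ : Γ, γ = 1 ∨ γ = σ := fun γ => or_iff_not_imp_left.2 (hσ' γ)
  let s : A →ₐ[k] A := (τ σ : A ≃ₐ[k] A)
  let t : g →ₗ⁅k⁆ g := (θ σ : g ≃ₗ⁅k⁆ g)
  have hs : ∀ a, s (s a) = a := fun a => by
    change (τ σ * τ σ) a = a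
    rw [← map_mul, hσσ, map_one]; rfl
  have ht : ∀ u, t (t u) = u := fun u => by
    change (θ σ * θ σ) u = u
    rw [← map_mul, hσσ, map_one]; rfl
  -- homogeneous tensors are equivariant maps
  have hmem : ∀ {a u}, Homog s t a u → a ⊗ₜ[k] u ∈ mapAlgebra τ θ := by
    rintro a u ⟨ε, hε, ha, hu⟩ γ
    rw [LieAlgebra.ExtendScalars.map_apply_tmul]
    rcases hall γ with rfl | rfl
    · have h₁ : θ 1 u = u := by rw [map_one]; rfl
      simp [h₁]
    · change s a ⊗ₜ[k] t u = _
      rw [ha, hu, TensorProduct.smul_tmul_smul, hε, one_smul]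
  -- Averaging over `Γ` is a projection; composing with it extends linear forms from the equivariant
  -- maps to all of `A ⊗ g`.
  let P : A ⊗[k] g →ₗ[k] mapAlgebra τ θ := (Fintype.card Γ : k)⁻¹ • groupSum τ θ
  have hcard : (Fintype.card Γ : k) ≠ 0 := Nat.cast_ne_zero.2 Fintype.card_ne_zero
  have hP : ∀ α : mapAlgebra τ θ, P α = α := fun α => by
    rw [LinearMap.smul_apply, groupSum_coe, smul_smul, inv_mul_cancel₀ hcard, one_smul]
  have hPt : ∀ {a u} (h : Homog s t a u), P (a ⊗ₜ u) = ⟨a ⊗ₜ u, hmem h⟩ := fun h => hP ⟨_, hmem h⟩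
  have hPlie : ∀ {a b u v} (h : Homog s t a u) (h' : Homog s t b v),
      P ((a * b) ⊗ₜ ⁅u, v⁆) = ⁅(⟨a ⊗ₜ u, hmem h⟩ : mapAlgebra τ θ), ⟨b ⊗ₜ v, hmem h'⟩⁆ :=
    fun h h' => hPt (h.mul_lie h')
  let lam : A ⊗[k] g →ₗ[k] k := (χ : mapAlgebra τ θ →ₗ[k] k) ∘ₗ P
  have hlam : ∀ a b u v, Homog s t a u → Homog s t b v → lam ((a * b) ⊗ₜ ⁅u, v⁆) = 0 := by
    intro a b u v h h'
    change χ (P _) = 0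
    rw [hPlie h h', LieAlgebra.lieCharacter_apply_lie]
  let J := orbitIdeal τ S
  have hJ : ∀ a ∈ J, s a ∈ J := fun a ha => map_mem_orbitIdeal τ ha σ
  have hagree : ∀ F G : A ⊗[k] g →ₗ[k] k,
      (∀ a ∈ J, ∀ u, Homog s t a u → F (a ⊗ₜ u) = G (a ⊗ₜ u)) →
      ∀ α : mapAlgebra τ θ, (∀ x ∈ S, evalMap x (α : A ⊗[k] g) = 0) → F α = G α :=
    fun F G hFG α hα => eq_of_eq_on_homog hs ht J hJ F G hFG α (α.2 σ)
      (rid_lTensor_mem_orbitIdeal τ θ α hα)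
  have hlamP : ∀ α : mapAlgebra τ θ, lam α = χ α := fun α => congrArg χ (hP α)
  have hvan : ∀ {a}, a ∈ J → ∀ u : g, ∀ x ∈ S, evalMap x (a ⊗ₜ[k] u) = 0 := fun {a} ha u x hx => by
    have h := ha x hx 1
    rw [actPoint_one] at h
    rw [evalMap_tmul, h, zero_smul]
  have hne : ∃ a ∈ J, ∃ u, Homog s t a u ∧ lam (a ⊗ₜ u) ≠ 0 := by
    by_contra! h
    refine hχ (isEvaluation_oneDim τ θ S hS χ fun α hα => ?_)
    rw [← hlamP]
    exact hagree lam 0 (fun a ha u hau => h a ha u hau) α hα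
  -- the action of maps vanishing on `S` is given by cocycles with values in `k_χ`
  obtain ⟨ρ, hρ⟩ := (E.incl : OneDim χ →ₗ[k] E.U).exists_leftInverse_of_injective
    (LinearMap.ker_eq_bot.2 E.incl_injective)
  have hρ' : ∀ c, ρ (E.incl c) = c := fun c => LinearMap.congr_fun hρ c
  have hact : ∀ α : mapAlgebra τ θ, (∀ x ∈ S, evalMap x (α : A ⊗[k] g) = 0) → ∀ y : E.U,
      ⁅α, y⁆ = E.incl (ρ ⁅α, y⁆) := by
    intro α hα y
    obtain ⟨c, hc⟩ := (E.exact ⁅α, y⁆).1 (by rw [LieModuleHom.map_lie, hSV α hα])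
    rw [← hc, hρ']
  have hinc : ∀ (l : mapAlgebra τ θ) (c : OneDim χ), ρ ⁅l, E.incl c⁆ = χ l • c := fun l c => by
    rw [← LieModuleHom.map_lie, hρ']; rfl
  have hcob : ∀ y : E.U, ∃ m : k, ∀ α : mapAlgebra τ θ,
      (∀ x ∈ S, evalMap x (α : A ⊗[k] g) = 0) → ρ ⁅α, y⁆ = (m * χ α : k) := by
    intro y
    let D : A ⊗[k] g →ₗ[k] k :=
      (ρ : E.U →ₗ[k] k) ∘ₗ
        (LieModule.toEnd k (mapAlgebra τ θ) E.U :
          mapAlgebra τ θ →ₗ[k] Module.End k E.U).flip y ∘ₗ P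
    have hDP : ∀ β, D β = ρ ⁅P β, y⁆ := fun _ => rfl
    have hD : ∀ a ∈ J, ∀ b ∈ J, ∀ u v, Homog s t a u → Homog s t b v →
        D ((a * b) ⊗ₜ ⁅u, v⁆) = lam (a ⊗ₜ u) * D (b ⊗ₜ v) - lam (b ⊗ₜ v) * D (a ⊗ₜ u) := by
      intro a ha b hb u v hau hbv
      have h₁ : lam (a ⊗ₜ u) = χ ⟨a ⊗ₜ u, hmem hau⟩ := congrArg χ (hPt hau)
      have h₂ : lam (b ⊗ₜ v) = χ ⟨b ⊗ₜ v, hmem hbv⟩ := congrArg χ (hPt hbv)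
      rw [hDP, hDP, hDP, hPlie hau hbv, hPt hau, hPt hbv, h₁, h₂, lie_lie, map_sub,
        hact ⟨b ⊗ₜ v, hmem hbv⟩ (hvan hb v) y, hact ⟨a ⊗ₜ u, hmem hau⟩ (hvan ha u) y,
        hinc, hinc, hρ', hρ']
      rfl
    rcases coboundary_or_evaluation hs ht hg.eq_zero_of_center J lam D hlam hD hne with
      ⟨m, hm⟩ | ⟨p, η, hp, ⟨a, ha, hpa⟩, hη⟩
    · refine ⟨m, fun α hα => ?_⟩
      have h := hagree D (m • lam) hm α hα
      rw [hDP, hP, LinearMap.smul_apply, hlamP] at h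
      exact h
    · exfalso
      have hfix : ∀ γ, actPoint τ γ p = p := by
        intro γ
        rcases hall γ with rfl | rfl
        · exact actPoint_one τ p
        · refine AlgHom.ext fun b => ?_
          rw [actPoint_apply, inv_eq_of_mul_eq_one_left hσσ]
          exact hp b
      -- The orbit of `p` is `{p}`, and it misses the orbits of `S` because `a ∈ J` is nonzero at
      -- `p`.
      refine hχ (isEvaluation_oneDim τ θ (insert p S) ?_ χ fun α hα => ?_)
      · rw [Finset.coe_insert]
        refine hS.insert fun x hx _ => ?_
        rw [Set.disjoint_left]
        rintro _ ⟨γ, rfl⟩ ⟨δ, hδ⟩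
        apply hpa
        rw [← hfix γ]
        exact (DFunLike.congr_fun hδ a).symm.trans (ha x hx δ)
      · rw [← hlamP, hagree lam (η ∘ₗ ((evalMap p : A ⊗[k] g →ₗ⁅k⁆ g) : A ⊗[k] g →ₗ[k] g)) ?_ α
          fun x hx => hα x (Finset.mem_insert_of_mem hx)]
        · change η (evalMap p (α : A ⊗[k] g)) = 0
          rw [hα p (Finset.mem_insert_self _ _), map_zero]
        · intro a ha u hau
          rw [hη a ha u hau]
          change _ = η (evalMap p (a ⊗ₜ u))
          rw [evalMap_tmul, map_smul, smul_eq_mul]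
  obtain ⟨α, hα, hαχ⟩ : ∃ α : mapAlgebra τ θ,
      (∀ x ∈ S, evalMap x (α : A ⊗[k] g) = 0) ∧ χ α ≠ 0 := by
    obtain ⟨a, ha, u, hau, h⟩ := hne
    exact ⟨⟨a ⊗ₜ u, hmem hau⟩, hvan ha u, by rwa [← hlamP]⟩
  let r : E.U →ₗ[k] OneDim χ :=
    (χ α)⁻¹ • (ρ ∘ₗ LieModule.toEnd k (mapAlgebra τ θ) E.U α)
  have hr : ∀ y, r y = (χ α)⁻¹ • ρ ⁅α, y⁆ := fun _ => rfl
  refine ⟨{ r with map_lie' := fun {l y} => ?_ }, fun c => ?_⟩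
  · change r ⁅l, y⁆ = χ l • r y
    obtain ⟨m, hm⟩ := hcob y
    -- `⁅α, l⁆` again vanishes on `S`, so it acts on `y` by a multiple of `χ ⁅α, l⁆ = 0`. Thus `α`
    -- and `l` commute on `y`, which makes `r` equivariant.
    have hker : ρ ⁅⁅α, l⁆, y⁆ = 0 := by
      rw [hm ⁅α, l⁆ fun x hx => ?_, LieAlgebra.lieCharacter_apply_lie, mul_zero]
      · rfl
      · change evalMap x ⁅(α : A ⊗[k] g), (l : A ⊗[k] g)⁆ = 0
        rw [LieHom.map_lie, hα x hx, zero_lie]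
    rw [hr, hr, leibniz_lie, map_add, hker, zero_add, hact α hα y, hinc, hρ', smul_comm]
  · change r (E.incl c) = c
    rw [hr, hinc, smul_smul, inv_mul_cancel₀ hαχ, one_smul]

end OrderTwo

end EquivariantMap

theorem proposition6p13 {k : Type*} [Field k] [IsAlgClosed k] [CharZero k]
    {A : Type*} [CommRing A] [Algebra k A] [Algebra.FiniteType k A]
    {g : Type*} [LieRing g] [LieAlgebra k g] [FiniteDimensional k g]
    (hg : EquivariantMap.IsReductive k g)
    {Γ : Type*} [Group Γ] (hΓ : Nat.card Γ = 2)
    (τ : Γ →* (A ≃ₐ[k] A)) (θ : Γ →* (g ≃ₗ⁅k⁆ g)) :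
    EquivariantMap.IsExtensionLocal τ θ := by
  intro V _ _ _ _ _ _ χ hV hχ
  obtain ⟨S, hS, hSV⟩ := EquivariantMap.IsEvaluation.exists_points τ θ hV
  exact EquivariantMap.subsingleton_ext1 fun E =>
    E.exists_retraction τ θ hg hΓ χ S hS hSV hχ
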